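/- Let $r \ge 0$. An \emph{$r$-coloured permutation} is a string $\mathbf a = \sigma_1^{\gamma_1}\cdots\sigma_n^{\gamma_n}$ ($n \ge 0$) of distinct positive integers $\sigma_i$ (its symbols) with colours $\gamma_i \in \{0,\dots,r-1\}$; $|\mathbf a| = n$ is its length. Order coloured integers by $\sigma^{\gamma} < \tau^{\delta}$ if and only if $\gamma > \delta$, or $\gamma = \delta$ and $\sigma < \tau$. Let $\mathrm{Des}(\mathbf a) \subseteq \{0,\dots,n-1\}$ consist of all $i \in \{1,\dots,n-1\}$ with $\sigma_i^{\gamma_i} > \sigma_{i+1}^{\gamma_{i+1}}$, together with $0$ if $n \ge 1$ and $\gamma_1 \ne 0$. Put $\mathrm{des}(\mathbf a) = |\mathrm{Des}(\mathbf a)|$, $\mathrm{comaj}(\mathbf a) = \sum_{i \in \mathrm{Des}(\mathbf a)} (n-i)$, and $\mathbf{col}(\mathbf a) = (\mathrm{col}_0(\mathbf a),\dots,\mathrm{col}_{r-1}(\mathbf a))$, where $\mathrm{col}_j(\mathbf a)$ is the number of $i$ with $\gamma_i = j$. Two coloured permutations are disjoint if they have no symbol in common; for disjoint $\mathbf a,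 \mathbf b$ let $\mathbf a \mathbin{\sqcup\!\sqcup} \mathbf b$ be the set of their shuffles. A \emph{coloured permutation statistic} $\mathrm{st}$ is a function on $r$-coloured permutations which depends only on the sequence of colours and on the relative order of the symbols. It is \emph{shuffle compatible} if for all disjoint $\mathbf a,\mathbf b$ the multiset $\{\!\{\mathrm{st}(\mathbf c) : \mathbf c \in \mathbf a \mathbin{\sqcup\!\sqcup} \mathbf b\}\!\}$ depends only on $\mathrm{st}(\mathbf a)$, $\mathrm{st}(\mathbf b)$, $|\mathbf a|$ and $|\mathbf b|$. In that case, call $\mathbf a, \mathbf b$ equivalent if $|\mathbf a| = |\mathbf b|$ and $\mathrm{st}(\mathbf a) = \mathrm{st}(\mathbf b)$, and write $[\mathbf a]_{\mathrm{st}}$ for the class of $\mathbf a$; the \emph{shuffle algebra} $\mathcal A^{(r)}_{\mathrm{st}}$ is the commutative unital $\mathbb Q$-algebra with basis the set of equivalence classes and multiplication $[\mathbf a]_{\mathrm{st}}[\mathbf b]_{\mathrm{st}} = \sum_{\mathbf c \in \mathbf a \mathbin{\sqcup\!\sqcup} \mathbf b} [\mathbf c]_{\mathrm{st}}$ for disjoint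 $\mathbf a, \mathbf b$. Let $p_0,\dots,p_{r-1},x,t$ be commuting variables, $\mathbf p = (p_0,\dots,p_{r-1})$, $\mathbf p^{\mathbf v} = p_0^{v_0}\cdots p_{r-1}^{v_{r-1}}$, and let $\mathbb Q[\mathbf p,x][[t*]]$ be the set $\mathbb Q[\mathbf p,x][[t]]$ with the usual addition and with multiplication given by the Hadamard product $\bigl(\sum_k a_k t^k\bigr) * \bigl(\sum_k b_k t^k\bigr) = \sum_k a_k b_k t^k$. \textbf{Theorem.} (i) The tuple of statistics $(\mathrm{des},\mathrm{comaj},\mathbf{col})$ is shuffle compatible. (ii) The $\mathbb Q$-linear map $H\colon \mathcal A^{(r)}_{(\mathrm{des},\mathrm{comaj},\mathbf{col})} \to \mathbb Q[\mathbf p,x][[t*]]$ defined by $$[\mathbf a] \mapsto \frac{\mathbf p^{\mathbf{col}(\mathbf a)}\, x^{\mathrm{comaj}(\mathbf a)}\, t^{\mathrm{des}(\mathbf a)}}{(1-t)(1-xt)\cdots(1-x^{|\mathbf a|}t)}$$ (the quotient being formed with the ordinary multiplication of power series in $t$) is an injective homomorphism of unital $\mathbb Q$-algebras. -/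

import Mathlib

noncomputable section

/-! ### Coloured permutations -/

/-- The symbols of a word of coloured positive integers `σ₁^γ₁ ⋯ σₙ^γₙ`, where `σ^γ` is the
pair `(σ, γ)`. -/
abbrev wordSymbols {r : ℕ} (w : List (ℕ+ × Fin r)) : List ℕ+ := w.map Prod.fst

/-- An `r`-coloured permutation `σ₁^γ₁ ⋯ σₙ^γₙ`: the symbols are distinct positive integers,
the colours are arbitrary elements of `{0, …, r - 1}`. -/
@[ext] structure ColPerm (r : ℕ) where
  word : List (ℕ+ × Fin r)
  nodup : (wordSymbols word).Nodup

/-- The colour order `⋯ < 1¹ < 2¹ < ⋯ < 1⁰ < 2⁰ < ⋯` on coloured positive integers. -/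
def colourLT {r : ℕ} (u v : ℕ+ × Fin r) : Prop :=
  v.2 < u.2 ∨ (u.2 = v.2 ∧ u.1 < v.1)

instance {r : ℕ} (u v : ℕ+ × Fin r) : Decidable (colourLT u v) := by
  unfold colourLT; infer_instance

namespace ColPerm

variable {r : ℕ}

/-- The length `|a|`. -/
def length (a : ColPerm r) : ℕ := a.word.length

/-- The coloured permutation of length zero. -/
def empty (r : ℕ) : ColPerm r := ⟨[], by simp⟩

/-- `a` and `b` have no symbol in common. -/
def IsDisjoint (a b : ColPerm r) : Prop :=
  List.Disjoint (wordSymbols a.word) (wordSymbols b.word)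

theorem IsDisjoint.symm {a b : ColPerm r} (h : a.IsDisjoint b) : b.IsDisjoint a :=
  List.Disjoint.symm h

/-- `i ∈ {0, …, n - 1}` is a descent: for `i = 0`, the first colour is not `0`; for `i ≥ 1`,
the `i`-th letter exceeds the `(i + 1)`-st in the colour order.  (The entry of the list with
index `i` is the `(i + 1)`-st letter.) -/
def IsDescent (a : ColPerm r) : ℕ → Prop
  | 0 => ∃ u ∈ a.word[0]?, (u.2 : ℕ) ≠ 0
  | i + 1 => ∃ u ∈ a.word[i]?, ∃ v ∈ a.word[i + 1]?, colourLT v u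

instance (a : ColPerm r) : DecidablePred a.IsDescent := by
  intro i; cases i <;> (unfold IsDescent; infer_instance)

/-- The descent set, a subset of `{0, …, n - 1}`. -/
def Des (a : ColPerm r) : Finset ℕ := (Finset.range a.length).filter a.IsDescent

/-- The descent number. -/
def des (a : ColPerm r) : ℕ := a.Des.card

/-- The comajor index `∑_{i ∈ Des a} (n - i)`; every `i ∈ Des a` satisfies `i < n`. -/
def comaj (a : ColPerm r) : ℕ := ∑ i ∈ a.Des, (a.length - i)

/-- The colour vector: `col a j` is the number of letters of colour `j`. -/
def col (a : ColPerm r) (j : Fin r) : ℕ := (a.word.map Prod.snd).count j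

/-- `a` and `b` have the same length, the same colours in the same positions, and symbols in the
same relative order. -/
def SameShape (a b : ColPerm r) : Prop :=
  a.word.map Prod.snd = b.word.map Prod.snd ∧
    ∀ (i j : ℕ) (hi : i < a.word.length) (hj : j < a.word.length)
      (hi' : i < b.word.length) (hj' : j < b.word.length),
      a.word[i].1 < a.word[j].1 ↔ b.word[i].1 < b.word[j].1

end ColPerm

/-! ### Shuffles -/

/-- The multiset of all shuffles of two words. -/
def shuffleWords {α : Type*} : List α → List α → Multiset (List α)
  | [], v => {v}
  | x :: u, [] => {x :: u}
  | x :: u, y :: v =>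
      (shuffleWords u (y :: v)).map (x :: ·) + (shuffleWords (x :: u) v).map (y :: ·)
termination_by u v => u.length + v.length

section ShuffleWords

variable {α : Type*}

theorem shuffleWords_nil_left (v : List α) : shuffleWords [] v = {v} := by
  rw [shuffleWords]

theorem shuffleWords_nil_right (u : List α) : shuffleWords u [] = {u} := by
  cases u <;> rw [shuffleWords]

theorem shuffleWords_cons_cons (x y : α) (u v : List α) :
    shuffleWords (x :: u) (y :: v) =
      (shuffleWords u (y :: v)).map (x :: ·) + (shuffleWords (x :: u) v).map (y :: ·) := by
  rw [shuffleWords]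

theorem shuffleWords_comm : ∀ u v : List α, shuffleWords u v = shuffleWords v u
  | [], v => by rw [shuffleWords_nil_left, shuffleWords_nil_right]
  | x :: u, [] => by rw [shuffleWords_nil_left, shuffleWords_nil_right]
  | x :: u, y :: v => by
      rw [shuffleWords_cons_cons, shuffleWords_cons_cons, shuffleWords_comm u (y :: v),
        shuffleWords_comm (x :: u) v, add_comm]
termination_by u v => u.length + v.length

theorem perm_of_mem_shuffleWords : ∀ (u v : List α) {w : List α},
    w ∈ shuffleWords u v → w.Perm (u ++ v)
  | [], v, w, h => by
      rw [shuffleWords_nil_left, Multiset.mem_singleton] at h; simp [h]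
  | x :: u, [], w, h => by
      rw [shuffleWords_nil_right, Multiset.mem_singleton] at h; simp [h]
  | x :: u, y :: v, w, h => by
      rw [shuffleWords_cons_cons, Multiset.mem_add, Multiset.mem_map, Multiset.mem_map] at h
      rcases h with ⟨w', hw', rfl⟩ | ⟨w', hw', rfl⟩
      · exact (perm_of_mem_shuffleWords u (y :: v) hw').cons x
      · exact ((perm_of_mem_shuffleWords (x :: u) v hw').cons y).trans List.perm_middle.symm
termination_by u v => u.length + v.length

theorem shuffleWords_bind_cons (x y z : α) (u v w : List α) :
    (shuffleWords (x :: u) (y :: v)).bind (fun s => shuffleWords s (z :: w)) =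
      ((shuffleWords u (y :: v)).bind (fun s => shuffleWords s (z :: w))).map (x :: ·) +
      ((shuffleWords (x :: u) v).bind (fun s => shuffleWords s (z :: w))).map (y :: ·) +
      ((shuffleWords (x :: u) (y :: v)).bind (fun s => shuffleWords s w)).map (z :: ·) := by
  simp only [shuffleWords_cons_cons, Multiset.add_bind, Multiset.bind_map, Multiset.bind_add,
    Multiset.map_add, Multiset.map_bind]
  abel

theorem shuffleWords_bind_cycle : ∀ u v w : List α,
    (shuffleWords u v).bind (fun s => shuffleWords s w) =
      (shuffleWords v w).bind (fun s => shuffleWords s u)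
  | [], v, w => by
      rw [shuffleWords_nil_left, Multiset.singleton_bind]
      simp only [shuffleWords_nil_right]
      exact ((Multiset.bind_singleton _ fun x => x).trans (Multiset.map_id' _)).symm
  | x :: u, [], w => by
      simp [shuffleWords_nil_left, shuffleWords_nil_right, shuffleWords_comm w]
  | x :: u, y :: v, [] => by
      rw [shuffleWords_nil_right, Multiset.singleton_bind, shuffleWords_comm (x :: u)]
      simp only [shuffleWords_nil_right]
      exact (Multiset.bind_singleton _ fun x => x).trans (Multiset.map_id' _)
  | x :: u, y :: v, z :: w => by
      rw [shuffleWords_bind_cons, shuffleWords_bind_cons,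
        shuffleWords_bind_cycle u (y :: v) (z :: w),
        shuffleWords_bind_cycle (x :: u) v (z :: w),
        shuffleWords_bind_cycle (x :: u) (y :: v) w]
      abel
termination_by u v w => u.length + v.length + w.length

end ShuffleWords

namespace ColPerm

variable {r : ℕ}

theorem nodup_of_mem_shuffleWords {a b : ColPerm r} (h : a.IsDisjoint b)
    {w : List (ℕ+ × Fin r)} (hw : w ∈ shuffleWords a.word b.word) : (wordSymbols w).Nodup := by
  have hp := (perm_of_mem_shuffleWords _ _ hw).map Prod.fst
  rw [wordSymbols, hp.nodup_iff, List.map_append]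
  exact a.nodup.append b.nodup h

/-- The multiset of all shuffles of two disjoint coloured permutations. -/
def shuffle (a b : ColPerm r) (h : a.IsDisjoint b) : Multiset (ColPerm r) :=
  (shuffleWords a.word b.word).pmap ColPerm.mk fun _ hw => nodup_of_mem_shuffleWords h hw

theorem word_mem_of_mem_shuffle {a b c : ColPerm r} {h : a.IsDisjoint b}
    (hc : c ∈ a.shuffle b h) : c.word ∈ shuffleWords a.word b.word := by
  obtain ⟨w, hw, rfl⟩ := Multiset.mem_pmap.1 hc
  exact hw

theorem length_of_mem_shuffle {a b c : ColPerm r} {h : a.IsDisjoint b}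
    (hc : c ∈ a.shuffle b h) : c.length = a.length + b.length := by
  simpa [length] using (perm_of_mem_shuffleWords _ _ (word_mem_of_mem_shuffle hc)).length_eq

theorem disjoint_of_mem_shuffle {a b c d : ColPerm r} {h : a.IsDisjoint b}
    (hd : d ∈ a.shuffle b h) (hac : a.IsDisjoint c) (hbc : b.IsDisjoint c) :
    d.IsDisjoint c := by
  have hp := (perm_of_mem_shuffleWords _ _ (word_mem_of_mem_shuffle hd)).map Prod.fst
  intro s hs hs'
  rw [wordSymbols, hp.mem_iff, List.map_append, List.mem_append] at hs
  rcases hs with hs | hs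
  · exact hac hs hs'
  · exact hbc hs hs'

/-- Relabelling of the symbols by a strictly increasing map. -/
def relabel (a : ColPerm r) (f : ℕ+ → ℕ+) (hf : StrictMono f) : ColPerm r where
  word := a.word.map fun u => (f u.1, u.2)
  nodup := by
    have : wordSymbols (a.word.map fun u => (f u.1, u.2)) = (wordSymbols a.word).map f := by
      simp [wordSymbols]
    rw [this]
    exact a.nodup.map hf.injective

theorem sameShape_relabel (a : ColPerm r) (f : ℕ+ → ℕ+) (hf : StrictMono f) :
    a.SameShape (a.relabel f hf) := by
  refine ⟨by simp [relabel], fun i j hi hj hi' hj' => ?_⟩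
  simp [relabel, hf.lt_iff_lt]

theorem IsDisjoint.relabel {a b : ColPerm r} (h : a.IsDisjoint b) (f : ℕ+ → ℕ+)
    (hf : StrictMono f) : (a.relabel f hf).IsDisjoint (b.relabel f hf) := by
  have e : ∀ c : ColPerm r, wordSymbols (c.relabel f hf).word = (wordSymbols c.word).map f := by
    intro c; simp [wordSymbols, ColPerm.relabel]
  rw [IsDisjoint, e, e]
  exact List.disjoint_map hf.injective h

theorem length_relabel (a : ColPerm r) (f : ℕ+ → ℕ+) (hf : StrictMono f) :
    (a.relabel f hf).length = a.length := by simp [relabel, length]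

theorem SameShape.length_eq {a b : ColPerm r} (h : a.SameShape b) : a.length = b.length := by
  simpa [length] using congrArg List.length h.1

theorem SameShape.colour_eq {a b : ColPerm r} (h : a.SameShape b) (i : ℕ)
    (hi : i < a.word.length) (hi' : i < b.word.length) : a.word[i].2 = b.word[i].2 := by
  have := List.getElem_of_eq h.1 (i := i) (by simpa using hi)
  simpa using this

theorem SameShape.isDescent {a b : ColPerm r} (h : a.SameShape b) (i : ℕ) :
    a.IsDescent i ↔ b.IsDescent i := by
  have hl : a.word.length = b.word.length := h.length_eq
  cases i with
  | zero =>
    by_cases h0 : 0 < a.word.length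
    · have h0' : 0 < b.word.length := hl ▸ h0
      simp [IsDescent, List.getElem?_eq_getElem h0, List.getElem?_eq_getElem h0',
        h.colour_eq 0 h0 h0']
    · have h0' : ¬ 0 < b.word.length := hl ▸ h0
      simp only [not_lt, Nat.le_zero] at h0 h0'
      simp [IsDescent, List.length_eq_zero_iff.1 h0, List.length_eq_zero_iff.1 h0']
  | succ i =>
    by_cases h1 : i + 1 < a.word.length
    · have h1' : i + 1 < b.word.length := hl ▸ h1
      have h0 : i < a.word.length := by omega
      have h0' : i < b.word.length := by omega
      simp [IsDescent, List.getElem?_eq_getElem h0, List.getElem?_eq_getElem h0',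
        List.getElem?_eq_getElem h1, List.getElem?_eq_getElem h1', colourLT,
        h.colour_eq i h0 h0', h.colour_eq (i + 1) h1 h1', h.2 (i + 1) i h1 h0 h1' h0']
    · have h1' : ¬ i + 1 < b.word.length := hl ▸ h1
      simp [IsDescent, List.getElem?_eq_none (not_lt.1 h1), List.getElem?_eq_none (not_lt.1 h1')]

theorem SameShape.Des_eq {a b : ColPerm r} (h : a.SameShape b) : a.Des = b.Des := by
  unfold Des
  rw [h.length_eq]
  exact Finset.filter_congr fun i _ => h.isDescent i

end ColPerm

/-! ### Coloured permutation statistics -/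

/-- A coloured permutation statistic with values in `β`: a function on `r`-coloured permutations
that depends only on the colours and on the relative order of the symbols. -/
structure ColPermStat (r : ℕ) (β : Type*) where
  toFun : ColPerm r → β
  eq_of_sameShape : ∀ a b : ColPerm r, a.SameShape b → toFun a = toFun b

instance {r : ℕ} {β : Type*} : CoeFun (ColPermStat r β) (fun _ => ColPerm r → β) :=
  ⟨ColPermStat.toFun⟩

/-- The triple of statistics `(des, comaj, col)`. -/
def desComajCol (r : ℕ) : ColPermStat r (ℕ × ℕ × (Fin r → ℕ)) where
  toFun a := (a.des, a.comaj, a.col)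
  eq_of_sameShape a b h := by
    have hcol : a.col = b.col := by
      funext j
      simp only [ColPerm.col, h.1]
    simp [ColPerm.des, ColPerm.comaj, h.Des_eq, h.length_eq, hcol]

namespace ColPermStat

variable {r : ℕ} {β : Type*}

/-- `st` is shuffle compatible: for disjoint `a` and `b`, the multiset of the values of `st` on
the shuffles of `a` and `b` depends only on `st a`, `st b`, `|a|` and `|b|`. -/
def ShuffleCompatible (st : ColPermStat r β) : Prop :=
  ∀ (a b a' b' : ColPerm r) (h : a.IsDisjoint b) (h' : a'.IsDisjoint b'),
    a.length = a'.length → b.length = b'.length → st a = st a' → st b = st b' →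
      (a.shuffle b h).map st = (a'.shuffle b' h').map st

/-- `st`-equivalence of coloured permutations: same length and same value of `st`. -/
def equivalence (st : ColPermStat r β) : Setoid (ColPerm r) where
  r a b := a.length = b.length ∧ st a = st b
  iseqv := ⟨fun _ => ⟨rfl, rfl⟩, fun h => ⟨h.1.symm, h.2.symm⟩,
    fun h h' => ⟨h.1.trans h'.1, h.2.trans h'.2⟩⟩

/-- The set of `st`-equivalence classes. -/
abbrev Class (st : ColPermStat r β) : Type := Quotient st.equivalence

end ColPermStat

/-! ### The shuffle algebra -/

/-- The shuffle algebra of a shuffle-compatible statistic: the `ℚ`-vector space with basis the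
set of `st`-equivalence classes, with the multiplication defined below. -/
def ShuffleAlgebra {r : ℕ} {β : Type*} (st : ColPermStat r β) (_hst : st.ShuffleCompatible) :
    Type := st.Class →₀ ℚ

namespace ShuffleAlgebra

variable {r : ℕ} {β : Type*} {st : ColPermStat r β}

instance (hst : st.ShuffleCompatible) : AddCommGroup (ShuffleAlgebra st hst) :=
  inferInstanceAs (AddCommGroup (st.Class →₀ ℚ))

instance (hst : st.ShuffleCompatible) : Module ℚ (ShuffleAlgebra st hst) :=
  inferInstanceAs (Module ℚ (st.Class →₀ ℚ))

/-- The basis of the shuffle algebra given by the `st`-equivalence classes. -/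
def basis (hst : st.ShuffleCompatible) : Module.Basis st.Class ℚ (ShuffleAlgebra st hst) :=
  Module.Basis.ofRepr (LinearEquiv.refl ℚ (st.Class →₀ ℚ))

/-- The basis element `[a]`. -/
def cls (hst : st.ShuffleCompatible) (a : ColPerm r) : ShuffleAlgebra st hst :=
  basis hst (Quotient.mk st.equivalence a)

theorem cls_eq (hst : st.ShuffleCompatible) {a b : ColPerm r} (hl : a.length = b.length)
    (hs : st a = st b) : cls hst a = cls hst b :=
  congrArg (basis hst) (Quotient.sound (s := st.equivalence) ⟨hl, hs⟩)

theorem map_cls_eq (hst : st.ShuffleCompatible) {a b a' b' : ColPerm r} (h : a.IsDisjoint b)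
    (h' : a'.IsDisjoint b') (hla : a.length = a'.length) (hlb : b.length = b'.length)
    (hsa : st a = st a') (hsb : st b = st b') :
    (a.shuffle b h).map (cls hst) = (a'.shuffle b' h').map (cls hst) := by
  classical
  let g : β → ShuffleAlgebra st hst := fun x =>
    if hx : ∃ c : ColPerm r, c.length = a.length + b.length ∧ st c = x
    then cls hst hx.choose else 0
  have hg : ∀ c : ColPerm r, c.length = a.length + b.length → cls hst c = g (st c) := by
    intro c hc
    have hx : ∃ d : ColPerm r, d.length = a.length + b.length ∧ st d = st c := ⟨c, hc, rfl⟩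
    simp only [g, dif_pos hx]
    exact cls_eq hst (hc.trans hx.choose_spec.1.symm) hx.choose_spec.2.symm
  have e1 : (a.shuffle b h).map (cls hst) = ((a.shuffle b h).map st).map g := by
    rw [Multiset.map_map]
    exact Multiset.map_congr rfl fun c hc => hg c (ColPerm.length_of_mem_shuffle hc)
  have e2 : (a'.shuffle b' h').map (cls hst) = ((a'.shuffle b' h').map st).map g := by
    rw [Multiset.map_map]
    exact Multiset.map_congr rfl fun c hc =>
      hg c (by rw [ColPerm.length_of_mem_shuffle hc, hla, hlb])
  rw [e1, e2, hst a b a' b' h h' hla hlb hsa hsb]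

theorem strictMono_even : StrictMono (fun s : ℕ+ => 2 * s) :=
  fun _ _ h => mul_lt_mul_right h 2

theorem strictMono_odd : StrictMono (fun s : ℕ+ => 2 * s + 1) :=
  fun _ _ h => add_lt_add_left (strictMono_even h) 1

/-- `a` with its symbols doubled. -/
def toEven (a : ColPerm r) : ColPerm r := a.relabel _ strictMono_even

/-- `a` with its symbols moved to odd numbers. -/
def toOdd (a : ColPerm r) : ColPerm r := a.relabel _ strictMono_odd

theorem disjoint_even_odd (a b : ColPerm r) : (toEven a).IsDisjoint (toOdd b) := by
  intro s hs hs'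
  simp only [toEven, toOdd, ColPerm.relabel, wordSymbols, List.map_map, List.mem_map,
    Function.comp] at hs hs'
  obtain ⟨u, -, rfl⟩ := hs
  obtain ⟨v, -, hv⟩ := hs'
  have := congrArg PNat.val hv
  simp only [PNat.add_coe, PNat.mul_coe, PNat.val_ofNat] at this
  omega

theorem cls_toEven (hst : st.ShuffleCompatible) (a : ColPerm r) :
    cls hst (toEven a) = cls hst a :=
  cls_eq hst (a.length_relabel _ _) (st.eq_of_sameShape _ _ (a.sameShape_relabel _ _)).symm

theorem cls_toOdd (hst : st.ShuffleCompatible) (a : ColPerm r) :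
    cls hst (toOdd a) = cls hst a :=
  cls_eq hst (a.length_relabel _ _) (st.eq_of_sameShape _ _ (a.sameShape_relabel _ _)).symm

/-- The product of two equivalence classes, computed with representatives on disjoint sets of
symbols; see `cls_mul_cls` for the rule with arbitrary disjoint representatives. -/
def classMul (hst : st.ShuffleCompatible) (p q : st.Class) : ShuffleAlgebra st hst :=
  Quotient.liftOn₂ p q
    (fun a b => (((toEven a).shuffle (toOdd b) (disjoint_even_odd a b)).map (cls hst)).sum)
    (fun a b a' b' ha hb => by
      refine congrArg Multiset.sum (map_cls_eq hst _ _ ?_ ?_ ?_ ?_)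
      · simpa [toEven, ColPerm.length_relabel] using ha.1
      · simpa [toOdd, ColPerm.length_relabel] using hb.1
      · exact ((st.eq_of_sameShape _ _ (a.sameShape_relabel _ _)).symm.trans ha.2).trans
          (st.eq_of_sameShape _ _ (a'.sameShape_relabel _ _))
      · exact ((st.eq_of_sameShape _ _ (b.sameShape_relabel _ _)).symm.trans hb.2).trans
          (st.eq_of_sameShape _ _ (b'.sameShape_relabel _ _)))

/-- The bilinear extension of the product of equivalence classes. -/
def mulMap (hst : st.ShuffleCompatible) :
    ShuffleAlgebra st hst →ₗ[ℚ] ShuffleAlgebra st hst →ₗ[ℚ] ShuffleAlgebra st hst :=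
  (basis hst).constr ℚ fun p => (basis hst).constr ℚ fun q => classMul hst p q

instance (hst : st.ShuffleCompatible) : Mul (ShuffleAlgebra st hst) :=
  ⟨fun x y => mulMap hst x y⟩

instance (hst : st.ShuffleCompatible) : One (ShuffleAlgebra st hst) :=
  ⟨cls hst (ColPerm.empty r)⟩

theorem mul_def (hst : st.ShuffleCompatible) (x y : ShuffleAlgebra st hst) :
    x * y = mulMap hst x y := rfl

/-- The defining rule `[a] [b] = ∑_{c ∈ a ⧢ b} [c]` for disjoint `a` and `b`. -/
theorem cls_mul_cls (hst : st.ShuffleCompatible) (a b : ColPerm r) (h : a.IsDisjoint b) :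
    cls hst a * cls hst b = ((a.shuffle b h).map (cls hst)).sum := by
  rw [mul_def, cls, cls, mulMap, Module.Basis.constr_basis, Module.Basis.constr_basis]
  refine congrArg Multiset.sum (map_cls_eq hst _ _ ?_ ?_ ?_ ?_)
  · exact a.length_relabel _ _
  · exact b.length_relabel _ _
  · exact (st.eq_of_sameShape _ _ (a.sameShape_relabel _ _)).symm
  · exact (st.eq_of_sameShape _ _ (b.sameShape_relabel _ _)).symm

/-- `cls` on words, with value `0` on words that are not coloured permutations. -/
def wordCls (hst : st.ShuffleCompatible) (w : List (ℕ+ × Fin r)) : ShuffleAlgebra st hst :=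
  open Classical in if h : (wordSymbols w).Nodup then cls hst ⟨w, h⟩ else 0

theorem wordCls_word (hst : st.ShuffleCompatible) (a : ColPerm r) :
    wordCls hst a.word = cls hst a := by
  simp [wordCls, a.nodup]

theorem map_word_shuffle (a b : ColPerm r) (h : a.IsDisjoint b) :
    (a.shuffle b h).map ColPerm.word = shuffleWords a.word b.word := by
  rw [ColPerm.shuffle, Multiset.map_pmap, Multiset.pmap_eq_map, Multiset.map_id']

theorem map_cls_shuffle (hst : st.ShuffleCompatible) (a b : ColPerm r) (h : a.IsDisjoint b) :
    (a.shuffle b h).map (cls hst) = (shuffleWords a.word b.word).map (wordCls hst) := by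
  rw [← map_word_shuffle a b h, Multiset.map_map]
  exact Multiset.map_congr rfl fun c _ => (wordCls_word hst c).symm

theorem induction_cls (hst : st.ShuffleCompatible) {P : ShuffleAlgebra st hst → Prop}
    (x : ShuffleAlgebra st hst) (zero : P 0) (add : ∀ x y, P x → P y → P (x + y))
    (smul : ∀ (t : ℚ) (x), P x → P (t • x)) (cls : ∀ a, P (cls hst a)) : P x := by
  have hx : x ∈ Submodule.span ℚ (Set.range (basis hst)) := by
    rw [(basis hst).span_eq]; trivial
  induction hx using Submodule.span_induction with
  | mem x h =>
    obtain ⟨q, rfl⟩ := h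
    exact q.inductionOn cls
  | zero => exact zero
  | add x y _ _ hx hy => exact add x y hx hy
  | smul t x _ hx => exact smul t x hx

theorem mul_comm' (hst : st.ShuffleCompatible) (x y : ShuffleAlgebra st hst) :
    x * y = y * x := by
  induction x using induction_cls hst with
  | zero => simp [mul_def]
  | add x x' hx hx' =>
    rw [mul_def] at hx hx' ⊢
    rw [map_add, LinearMap.add_apply, hx, hx', mul_def, mul_def, mul_def, map_add]
  | smul t x hx =>
    rw [mul_def] at hx ⊢
    rw [map_smul, LinearMap.smul_apply, hx, mul_def, mul_def, map_smul]
  | cls a =>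
    induction y using induction_cls hst with
    | zero => simp [mul_def]
    | add y y' hy hy' =>
      rw [mul_def] at hy hy' ⊢
      rw [map_add, hy, hy', mul_def, mul_def, mul_def, map_add, LinearMap.add_apply]
    | smul t y hy =>
      rw [mul_def] at hy ⊢
      rw [map_smul, hy, mul_def, mul_def, map_smul, LinearMap.smul_apply]
    | cls b =>
      have h := disjoint_even_odd a b
      rw [← cls_toEven hst a, ← cls_toOdd hst b, cls_mul_cls hst _ _ h,
        cls_mul_cls hst _ _ h.symm, map_cls_shuffle, map_cls_shuffle, shuffleWords_comm]

theorem sum_mul' (hst : st.ShuffleCompatible) (s : Multiset (ShuffleAlgebra st hst))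
    (y : ShuffleAlgebra st hst) : s.sum * y = (s.map (· * y)).sum := by
  induction s using Multiset.induction with
  | empty => simp [mul_def]
  | cons x s ih =>
    rw [Multiset.sum_cons, Multiset.map_cons, Multiset.sum_cons, ← ih]
    simp [mul_def]

theorem cls_mul_cls_mul_cls (hst : st.ShuffleCompatible) (a b c : ColPerm r)
    (hab : a.IsDisjoint b) (hac : a.IsDisjoint c) (hbc : b.IsDisjoint c) :
    cls hst a * cls hst b * cls hst c =
      (((shuffleWords a.word b.word).bind fun w => shuffleWords w c.word).map
        (wordCls hst)).sum := by
  rw [cls_mul_cls hst a b hab, sum_mul', Multiset.map_map, ← map_word_shuffle a b hab,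
    Multiset.bind_map, Multiset.map_bind, Multiset.sum_bind]
  refine congrArg Multiset.sum (Multiset.map_congr rfl fun d hd => ?_)
  rw [Function.comp, cls_mul_cls hst d c (ColPerm.disjoint_of_mem_shuffle hd hac hbc),
    map_cls_shuffle]

theorem cls_mul_assoc (hst : st.ShuffleCompatible) (a b c : ColPerm r) :
    cls hst a * cls hst b * cls hst c = cls hst a * (cls hst b * cls hst c) := by
  have key : ∀ a b c : ColPerm r, a.IsDisjoint b → a.IsDisjoint c → b.IsDisjoint c →
      cls hst a * cls hst b * cls hst c = cls hst a * (cls hst b * cls hst c) := by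
    intro a b c hab hac hbc
    rw [mul_comm' hst (cls hst a) (cls hst b * cls hst c),
      cls_mul_cls_mul_cls hst a b c hab hac hbc,
      cls_mul_cls_mul_cls hst b c a hbc hab.symm hac.symm, shuffleWords_bind_cycle]
  have h := key (toEven a) (toOdd (toEven b)) (toOdd (toOdd c)) (disjoint_even_odd _ _)
    (disjoint_even_odd _ _)
    ((disjoint_even_odd b c).relabel _ strictMono_odd)
  simpa only [cls_toEven, cls_toOdd] using h

theorem mul_assoc' (hst : st.ShuffleCompatible) (x y z : ShuffleAlgebra st hst) :
    x * y * z = x * (y * z) := by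
  induction x using induction_cls hst with
  | zero => simp [mul_def]
  | add x x' hx hx' => simp only [mul_def, map_add, LinearMap.add_apply] at *; rw [hx, hx']
  | smul t x hx => simp only [mul_def, map_smul, LinearMap.smul_apply] at *; rw [hx]
  | cls a =>
    induction y using induction_cls hst with
    | zero => simp [mul_def]
    | add y y' hy hy' => simp only [mul_def, map_add, LinearMap.add_apply] at *; rw [hy, hy']
    | smul t y hy => simp only [mul_def, map_smul, LinearMap.smul_apply] at *; rw [hy]
    | cls b =>
      induction z using induction_cls hst with
      | zero => simp [mul_def]
      | add z z' hz hz' => simp only [mul_def, map_add] at *; rw [hz, hz']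
      | smul t z hz => simp only [mul_def, map_smul] at *; rw [hz]
      | cls c => exact cls_mul_assoc hst a b c

theorem one_mul' (hst : st.ShuffleCompatible) (x : ShuffleAlgebra st hst) : 1 * x = x := by
  induction x using induction_cls hst with
  | zero => simp [mul_def]
  | add x x' hx hx' => simp only [mul_def, map_add] at *; rw [hx, hx']
  | smul t x hx => simp only [mul_def, map_smul] at *; rw [hx]
  | cls a =>
    have h : (ColPerm.empty r).IsDisjoint a := by
      intro s hs; simp [ColPerm.empty] at hs
    change cls hst (ColPerm.empty r) * cls hst a = cls hst a
    rw [cls_mul_cls hst _ _ h, map_cls_shuffle, ColPerm.empty, shuffleWords_nil_left,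
      Multiset.map_singleton, Multiset.sum_singleton, wordCls_word]

instance (hst : st.ShuffleCompatible) : CommRing (ShuffleAlgebra st hst) where
  __ := (inferInstance : AddCommGroup (ShuffleAlgebra st hst))
  mul_assoc := mul_assoc' hst
  mul_comm := mul_comm' hst
  one_mul := one_mul' hst
  mul_one x := by rw [mul_comm' hst, one_mul' hst]
  left_distrib x y z := by simp only [mul_def, map_add]
  right_distrib x y z := by simp only [mul_def, map_add, LinearMap.add_apply]
  zero_mul x := by simp [mul_def]
  mul_zero x := by simp [mul_def]

instance (hst : st.ShuffleCompatible) : Algebra ℚ (ShuffleAlgebra st hst) :=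
  Algebra.ofModule
    (fun t x y => by simp only [mul_def, map_smul, LinearMap.smul_apply])
    (fun t x y => by simp only [mul_def, map_smul])

end ShuffleAlgebra

/-! ### Power series with the Hadamard product -/

/-- The ring `R⟦t∗⟧`: formal power series in `t` with their usual addition and scalar
multiplication, and with the Hadamard (coefficientwise) product as multiplication. -/
def HadamardSeries (R : Type*) : Type _ := PowerSeries R

namespace HadamardSeries

variable {R : Type*} [CommRing R]

/-- A power series, regarded as an element of `R⟦t∗⟧`. -/
def ofPowerSeries (f : PowerSeries R) : HadamardSeries R := f

/-- The coefficient of `t ^ n`. -/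
def coeff (n : ℕ) (f : HadamardSeries R) : R := PowerSeries.coeff n (show PowerSeries R from f)

instance : AddCommGroup (HadamardSeries R) := inferInstanceAs (AddCommGroup (PowerSeries R))

instance [Algebra ℚ R] : Module ℚ (HadamardSeries R) :=
  inferInstanceAs (Module ℚ (PowerSeries R))

/-- The Hadamard product. -/
instance : Mul (HadamardSeries R) :=
  ⟨fun f g => ofPowerSeries (PowerSeries.mk fun n => coeff n f * coeff n g)⟩

/-- The unit for the Hadamard product: the series `∑ tⁿ = 1 / (1 - t)`. -/
instance : One (HadamardSeries R) := ⟨ofPowerSeries (PowerSeries.mk fun _ => 1)⟩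

@[ext] theorem ext {f g : HadamardSeries R} (h : ∀ n, coeff n f = coeff n g) : f = g :=
  PowerSeries.ext h

theorem coeff_mul (n : ℕ) (f g : HadamardSeries R) :
    coeff n (f * g) = coeff n f * coeff n g :=
  PowerSeries.coeff_mk n fun n => coeff n f * coeff n g

theorem coeff_one (n : ℕ) : coeff n (1 : HadamardSeries R) = 1 :=
  PowerSeries.coeff_mk n fun _ => (1 : R)

theorem coeff_zero (n : ℕ) : coeff n (0 : HadamardSeries R) = 0 :=
  map_zero (PowerSeries.coeff (R := R) n)

theorem coeff_add (n : ℕ) (f g : HadamardSeries R) :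
    coeff n (f + g) = coeff n f + coeff n g := map_add (PowerSeries.coeff (R := R) n) f g

theorem coeff_smul [Algebra ℚ R] (n : ℕ) (c : ℚ) (f : HadamardSeries R) :
    coeff n (c • f) = c • coeff n f := rfl

instance : CommRing (HadamardSeries R) where
  __ := (inferInstance : AddCommGroup (HadamardSeries R))
  mul_assoc f g h := by ext n; simp only [coeff_mul, mul_assoc]
  mul_comm f g := by ext n; simp only [coeff_mul, mul_comm]
  one_mul f := by ext n; simp only [coeff_mul, coeff_one, one_mul]
  mul_one f := by ext n; simp only [coeff_mul, coeff_one, mul_one]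
  left_distrib f g h := by ext n; simp only [coeff_mul, coeff_add, mul_add]
  right_distrib f g h := by ext n; simp only [coeff_mul, coeff_add, add_mul]
  zero_mul f := by ext n; simp only [coeff_mul, coeff_zero, zero_mul]
  mul_zero f := by ext n; simp only [coeff_mul, coeff_zero, mul_zero]

instance [Algebra ℚ R] : Algebra ℚ (HadamardSeries R) :=
  Algebra.ofModule
    (fun c f g => by ext n; simp only [coeff_mul, coeff_smul, smul_mul_assoc])
    (fun c f g => by ext n; simp only [coeff_mul, coeff_smul, mul_smul_comm])

end HadamardSeries

/-! ### The generating function of a coloured permutation -/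

/-- The polynomial ring `ℚ[p₀, …, p_{r-1}, x]`: the variable `some j` is `p_j`, and `none`
is `x`. -/
abbrev PolyPX (r : ℕ) : Type := MvPolynomial (Option (Fin r)) ℚ

namespace ColPerm

variable {r : ℕ}

/-- The monomial `p^{col(a)} x^{comaj(a)}`. -/
def weight (a : ColPerm r) : PolyPX r :=
  (∏ j : Fin r, MvPolynomial.X (some j) ^ a.col j) * MvPolynomial.X none ^ a.comaj

/-- The denominator `(1 - t) (1 - x t) ⋯ (1 - x^{|a|} t)`, with the usual multiplication of
power series in `t`. -/
def denominator (a : ColPerm r) : PowerSeries (PolyPX r) :=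
  ∏ i ∈ Finset.range (a.length + 1),
    (1 - PowerSeries.C (MvPolynomial.X none ^ i) * PowerSeries.X)

/-- The rational power series
`p^{col(a)} x^{comaj(a)} t^{des(a)} / ((1 - t) (1 - x t) ⋯ (1 - x^{|a|} t))`.
The denominator has constant term `1`, so `PowerSeries.invOfUnit _ 1` is its inverse. -/
def genFun (a : ColPerm r) : PowerSeries (PolyPX r) :=
  PowerSeries.C a.weight * PowerSeries.X ^ a.des * PowerSeries.invOfUnit a.denominator 1

theorem genFun_mul_denominator (a : ColPerm r) :
    a.genFun * a.denominator = PowerSeries.C a.weight * PowerSeries.X ^ a.des := by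
  have h : PowerSeries.constantCoeff a.denominator = ((1 : (PolyPX r)ˣ) : PolyPX r) := by
    simp [denominator, map_prod]
  rw [genFun, mul_assoc, mul_comm (PowerSeries.invOfUnit _ _), PowerSeries.mul_invOfUnit _ _ h,
    mul_one]

end ColPerm

end

/-! The proof goes through P-partitions. Expanding the rational function in `t`, the coefficient of
`t ^ k` in `a.genFun` is `p^col` times the sum of `x ^ (f₁ + ⋯ + fₙ)` over all `0 ≤ f₁ ≤ ⋯ ≤ fₙ ≤ k`
that increase strictly at the descents `i ≥ 1` and satisfy `0 < f₁` if the first colour is not `0`.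
This is `coeff_genFun`; it rests on a recursion that removes the first letter and contributes one
factor of the denominator.

Cutting a word after the letters with `f = 0` gives `a ++ b` with `a` increasing; on `b`, `f` is
lowered by `1`, at the cost of `q ^ b.length`. No condition arises at the cut, where `f` increases
strictly. Hence the sums are iterated convolutions, over deconcatenations, of the indicator of
increasing words with powers of `q`. Convolution preserves multiplicativity under shuffles because
deconcatenation is compatible with shuffles (`shuffleSum_splitSum`), and the indicator is
multiplicative because two disjoint increasing words have exactly one increasing shuffle. The
condition on the first colour fits in because an increasing word has weakly decreasing colours: its
first colour is `0` iff all its colours are `0`, and the latter condition is multiplicative. So each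
coefficient of `genFun` is a character, which is multiplicativity for the Hadamard product.

Both remaining claims follow by clearing denominators. For a fixed length the denominator is common,
and the numerators are monomials that record `(des, comaj, col)`; so a sum of generating functions
determines the multiset of statistics, which gives shuffle compatibility. For injectivity, different
lengths are separated by the total degree in `p₀, …, p_{r-1}`, which is the length. -/

noncomputable section

/-! ### Sums over shuffles and over deconcatenations -/

section ShuffleSum

variable {α R : Type*} [CommRing R]

/-- The sum of the values of `φ` on the shuffles of `u` and `v`. -/
def shuffleSum (φ : List α → R) (u v : List α) : R := ((shuffleWords u v).map φ).sum

theorem shuffleSum_nil_left (φ : List α → R) (v : List α) : shuffleSum φ [] v = φ v := by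
  simp [shuffleSum, shuffleWords_nil_left]

theorem shuffleSum_nil_right (φ : List α → R) (u : List α) : shuffleSum φ u [] = φ u := by
  simp [shuffleSum, shuffleWords_nil_right]

theorem shuffleSum_cons_cons (φ : List α → R) (x y : α) (u v : List α) :
    shuffleSum φ (x :: u) (y :: v) =
      shuffleSum (fun c => φ (x :: c)) u (y :: v) +
        shuffleSum (fun c => φ (y :: c)) (x :: u) v := by
  simp [shuffleSum, shuffleWords_cons_cons, Multiset.map_map]

theorem shuffleSum_add (φ ψ : List α → R) (u v : List α) :
    shuffleSum (fun c => φ c + ψ c) u v = shuffleSum φ u v + shuffleSum ψ u v := by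
  simp [shuffleSum, Multiset.sum_map_add]

theorem shuffleSum_const_mul (s : R) (φ : List α → R) (u v : List α) :
    shuffleSum (fun c => s * φ c) u v = s * shuffleSum φ u v := by
  simp [shuffleSum, Multiset.sum_map_mul_left]

theorem shuffleSum_mul_const (s : R) (φ : List α → R) (u v : List α) :
    shuffleSum (fun c => φ c * s) u v = shuffleSum φ u v * s := by
  simp [shuffleSum, Multiset.sum_map_mul_right]

theorem shuffleSum_congr {φ ψ : List α → R} {u v : List α}
    (h : ∀ c, c.Perm (u ++ v) → φ c = ψ c) : shuffleSum φ u v = shuffleSum ψ u v :=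
  congrArg Multiset.sum
    (Multiset.map_congr rfl fun c hc => h c (perm_of_mem_shuffleWords u v hc))

/-- The sum of the values of `F` on the pairs of words with concatenation `w`. -/
def splitSum (F : List α → List α → R) : List α → R
  | [] => F [] []
  | x :: w => F [] (x :: w) + splitSum (fun a b => F (x :: a) b) w

theorem splitSum_congr {w : List α} {F G : List α → List α → R}
    (h : ∀ a b, a ++ b = w → F a b = G a b) : splitSum F w = splitSum G w := by
  induction w generalizing F G with
  | nil => exact h _ _ rfl
  | cons x w ih =>
    rw [splitSum, splitSum, h [] _ rfl, ih fun a b hab => h _ _ (by rw [List.cons_append, hab])]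

theorem splitSum_add (F G : List α → List α → R) (w : List α) :
    splitSum (fun a b => F a b + G a b) w = splitSum F w + splitSum G w := by
  induction w generalizing F G with
  | nil => rfl
  | cons x w ih => rw [splitSum, ih, splitSum, splitSum]; ring

theorem splitSum_const_mul (s : R) (F : List α → List α → R) (w : List α) :
    splitSum (fun a b => s * F a b) w = s * splitSum F w := by
  induction w generalizing F with
  | nil => rfl
  | cons x w ih => rw [splitSum, ih, splitSum]; ring

theorem splitSum_zero (w : List α) : splitSum (fun _ _ => (0 : R)) w = 0 := by
  simpa using splitSum_const_mul (0 : R) (fun _ _ => 0) w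

theorem splitSum_mul_splitSum (F G : List α → List α → R) (u v : List α) :
    splitSum F u * splitSum G v =
      splitSum (fun a b => splitSum (fun c d => F a b * G c d) v) u := by
  simp_rw [splitSum_const_mul]
  rw [mul_comm, ← splitSum_const_mul]
  simp_rw [mul_comm]

/-- A family of elements closed under addition contains every sum over deconcatenations of its
members. -/
theorem splitSum_mem (S : AddSubmonoid R) (F : List α → List α → R) (h : ∀ a b, F a b ∈ S)
    (w : List α) : splitSum F w ∈ S := by
  induction w generalizing F with
  | nil => exact h _ _
  | cons x w ih => exact S.add_mem (h _ _) (ih _ fun a b => h _ _)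

/-- Deconcatenation is compatible with shuffles. -/
theorem shuffleSum_splitSum (F : List α → List α → R) : ∀ u v : List α,
    shuffleSum (splitSum F) u v =
      splitSum (fun u₁ u₂ => splitSum (fun v₁ v₂ =>
        shuffleSum (fun c => shuffleSum (F c) u₂ v₂) u₁ v₁) v) u
  | [], v => by
      simp only [shuffleSum_nil_left, splitSum]
  | x :: u, [] => by
      simp only [shuffleSum_nil_right, splitSum]
  | x :: u, y :: v => by
      rw [shuffleSum_cons_cons]
      -- Splits with empty left part contribute `F []` of the whole shuffle. In the others the left
      -- part starts with `x` or `y`, and the induction hypothesis applies to `F (x :: ·)` or `F (y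
      -- :: ·)`.
      simp only [splitSum, shuffleSum_add, shuffleSum_nil_left, shuffleSum_nil_right,
        shuffleSum_cons_cons, splitSum_add]
      rw [shuffleSum_splitSum (fun a b => F (x :: a) b) u (y :: v),
        shuffleSum_splitSum (fun a b => F (y :: a) b) (x :: u) v]
      simp only [splitSum, shuffleSum_nil_left, shuffleSum_nil_right, splitSum_add]
      ring
termination_by u v => u.length + v.length

end ShuffleSum

/-! ### Characters -/

section Character

variable {r : ℕ} {R : Type*} [CommRing R]

/-- The words `u` and `v` have no symbol in common. -/
def SymbolDisjoint (u v : List (ℕ+ × Fin r)) : Prop :=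
  List.Disjoint (wordSymbols u) (wordSymbols v)

theorem SymbolDisjoint.mono {u v u' v' : List (ℕ+ × Fin r)} (h : SymbolDisjoint u v)
    (hu : u' ⊆ u) (hv : v' ⊆ v) : SymbolDisjoint u' v' :=
  fun _ hs ht => h (List.map_subset _ hu hs) (List.map_subset _ hv ht)

/-- A function on words is a character if it is multiplicative for the shuffle product of words
without common symbols. -/
def IsShuffleCharacter (φ : List (ℕ+ × Fin r) → R) : Prop :=
  ∀ u v, SymbolDisjoint u v → shuffleSum φ u v = φ u * φ v

/-- Characters of a bialgebra are closed under convolution; here the coproduct is deconcatenation,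
and parts of symbol-disjoint words remain symbol-disjoint. -/
theorem IsShuffleCharacter.splitSum {φ ψ : List (ℕ+ × Fin r) → R} (hφ : IsShuffleCharacter φ)
    (hψ : IsShuffleCharacter ψ) : IsShuffleCharacter (splitSum fun a b => φ a * ψ b) := by
  intro u v h
  rw [shuffleSum_splitSum, splitSum_mul_splitSum]
  refine splitSum_congr fun a b hab => splitSum_congr fun c d hcd => ?_
  subst hab hcd
  simp_rw [shuffleSum_const_mul, shuffleSum_mul_const]
  rw [hφ a c (h.mono (by simp) (by simp)), hψ b d (h.mono (by simp) (by simp))]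
  ring

theorem IsShuffleCharacter.mul_left {φ m : List (ℕ+ × Fin r) → R} (hφ : IsShuffleCharacter φ)
    (hm : ∀ u v c, c.Perm (u ++ v) → m c = m u * m v) :
    IsShuffleCharacter fun w => m w * φ w := by
  intro u v h
  rw [shuffleSum_congr (ψ := fun c => m u * m v * φ c) fun c hc => by rw [hm u v c hc],
    shuffleSum_const_mul, hφ u v h]
  ring

theorem colourLT_trans {u v w : ℕ+ × Fin r} (h : colourLT u v) (h' : colourLT v w) :
    colourLT u w := by
  unfold colourLT at *
  rcases h with h | ⟨h, k⟩ <;> rcases h' with h' | ⟨h', k'⟩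
  · exact .inl (h'.trans h)
  · exact .inl (h' ▸ h)
  · exact .inl (h ▸ h')
  · exact .inr ⟨h.trans h', k.trans k'⟩

theorem colourLT_asymm {u v : ℕ+ × Fin r} (h : colourLT u v) : ¬ colourLT v u := by
  intro h'
  have := colourLT_trans h h'
  simp [colourLT] at this

theorem colourLT_or_colourLT {u v : ℕ+ × Fin r} (h : u.1 ≠ v.1) :
    colourLT u v ∨ colourLT v u := by
  unfold colourLT
  rcases lt_trichotomy u.2 v.2 with h1 | h1 | h1
  · exact .inr (.inl h1)
  · rcases lt_or_gt_of_ne h with h2 | h2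
    · exact .inl (.inr ⟨h1, h2⟩)
    · exact .inr (.inr ⟨h1.symm, h2⟩)
  · exact .inl (.inl h1)

/-- The indicator function of increasing words. -/
def incr (R : Type*) [CommRing R] (w : List (ℕ+ × Fin r)) : R :=
  if w.Pairwise colourLT then 1 else 0

/-- The indicator function of words with all colours equal to `0`. -/
def colourless (R : Type*) [CommRing R] (w : List (ℕ+ × Fin r)) : R :=
  if ∀ u ∈ w, (u.2 : ℕ) = 0 then 1 else 0

theorem incr_cons (x : ℕ+ × Fin r) (w : List (ℕ+ × Fin r)) :
    incr R (x :: w) = (if ∀ z ∈ w, colourLT x z then 1 else 0) * incr R w := by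
  simp only [incr, List.pairwise_cons, ite_and, ite_mul, one_mul, zero_mul]

theorem colourless_of_perm (u v c : List (ℕ+ × Fin r)) (h : c.Perm (u ++ v)) :
    colourless R c = colourless R u * colourless R v := by
  simp only [colourless, h.mem_iff, List.mem_append, or_imp, forall_and, ite_and, ite_mul,
    one_mul, zero_mul]

theorem pow_length_of_perm (s : R) (u v c : List (ℕ+ × Fin r)) (h : c.Perm (u ++ v)) :
    s ^ c.length = s ^ u.length * s ^ v.length := by
  rw [h.length_eq, List.length_append, pow_add]

/-- Two increasing words without common symbols merge into an increasing word in exactly one way: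
the smaller of the two first letters must come first. -/
theorem isShuffleCharacter_incr : ∀ u v : List (ℕ+ × Fin r), SymbolDisjoint u v →
    shuffleSum (incr R) u v = incr R u * incr R v
  | [], v, _ => by simp [shuffleSum_nil_left, incr]
  | x :: u, [], _ => by simp [shuffleSum_nil_right, incr]
  | x :: u, y :: v, h => by
      have hx := isShuffleCharacter_incr u (y :: v) (h.mono (by simp) (by simp))
      have hy := isShuffleCharacter_incr (x :: u) v (h.mono (by simp) (by simp))
      have e : ∀ (z : ℕ+ × Fin r) (a b : List (ℕ+ × Fin r)),
          shuffleSum (fun c => incr R (z :: c)) a b =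
            (if ∀ s ∈ a ++ b, colourLT z s then 1 else 0) * shuffleSum (incr R) a b := by
        intro z a b
        rw [← shuffleSum_const_mul]
        refine shuffleSum_congr fun c hc => ?_
        simp only [incr_cons, hc.mem_iff]
      rw [shuffleSum_cons_cons, e, e, hx, hy]
      have hxy : x.1 ≠ y.1 := fun he => h (a := x.1) (by simp) (by simp [he])
      simp only [incr_cons, List.mem_append, List.mem_cons, or_imp, forall_and, forall_eq]
      -- If `x` is not below all of `u`, or `y` not below all of `v`, every term vanishes. Otherwise
      -- comparing `x` with `y` leaves exactly one of the two summands.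
      by_cases hu : ∀ z ∈ u, colourLT x z <;> by_cases hv : ∀ z ∈ v, colourLT y z
      · rcases colourLT_or_colourLT hxy with hlt | hlt
        · have : ∀ z ∈ v, colourLT x z := fun z hz => colourLT_trans hlt (hv z hz)
          simp only [eq_true hu, eq_true hv, eq_true hlt, eq_true this,
            eq_false (colourLT_asymm hlt), ite_true, ite_false,
            and_true, false_and, and_self, one_mul, zero_mul, add_zero]
        · have : ∀ z ∈ u, colourLT y z := fun z hz => colourLT_trans hlt (hu z hz)
          simp only [eq_true hu, eq_true hv, eq_true hlt, eq_true this,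
            eq_false (colourLT_asymm hlt), ite_true, ite_false,
            false_and, and_false, and_self, one_mul, zero_mul, zero_add]
      · simp only [eq_false hv, and_false, ite_false, zero_mul, mul_zero, add_zero]
      · simp only [eq_false hu, false_and, ite_false, zero_mul, mul_zero, add_zero]
      · simp only [eq_false hu, eq_false hv, false_and, and_false, ite_false, zero_mul, mul_zero,
          add_zero]
termination_by u v => u.length + v.length

/-! ### The coefficients of the generating functions -/

/-- The generating function, by the sum of the values, of the `P`-partitions
`0 ≤ f₁ ≤ ⋯ ≤ fₙ ≤ k` of a word, with `fᵢ < fᵢ₊₁` at every descent `i ≥ 1`. -/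
def partitionSum (q : R) : ℕ → List (ℕ+ × Fin r) → R
  | 0 => incr R
  | k + 1 => splitSum fun a b => incr R a * (q ^ b.length * partitionSum q k b)

/-- The generating function, by the sum of the values, of the `P`-partitions
`0 ≤ f₁ ≤ ⋯ ≤ fₙ ≤ k` of a word, with `fᵢ < fᵢ₊₁` at every descent `i ≥ 1`, and with `0 < f₁`
if the first colour is not `0`. -/
def colouredPartitionSum (q : R) : ℕ → List (ℕ+ × Fin r) → R
  | 0 => fun a => colourless R a * incr R a
  | k + 1 => splitSum fun a b =>
      (colourless R a * incr R a) * (q ^ b.length * partitionSum q k b)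

theorem isShuffleCharacter_partitionSum (q : R) (k : ℕ) :
    IsShuffleCharacter (partitionSum (r := r) q k) := by
  induction k with
  | zero => exact isShuffleCharacter_incr
  | succ k ih =>
    exact IsShuffleCharacter.splitSum isShuffleCharacter_incr
      (ih.mul_left (pow_length_of_perm q))

/-- Only the first factor of the convolution changes. Requiring every colour to be `0`, not merely
the first, keeps this factor multiplicative. -/
theorem isShuffleCharacter_colouredPartitionSum (q : R) (k : ℕ) :
    IsShuffleCharacter (colouredPartitionSum (r := r) q k) := by
  have h0 : IsShuffleCharacter fun a : List (ℕ+ × Fin r) => colourless R a * incr R a :=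
    IsShuffleCharacter.mul_left isShuffleCharacter_incr colourless_of_perm
  cases k with
  | zero => exact h0
  | succ k =>
    exact h0.splitSum ((isShuffleCharacter_partitionSum q k).mul_left (pow_length_of_perm q))

theorem incr_nil : incr R ([] : List (ℕ+ × Fin r)) = 1 := by simp [incr]

theorem colourless_nil : colourless R ([] : List (ℕ+ × Fin r)) = 1 := by simp [colourless]

theorem partitionSum_nil (q : R) (k : ℕ) :
    partitionSum q k ([] : List (ℕ+ × Fin r)) = 1 := by
  induction k with
  | zero => exact incr_nil
  | succ k ih => simp [partitionSum, splitSum, incr_nil, ih]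

theorem partitionSum_singleton_zero (q : R) (x : ℕ+ × Fin r) :
    partitionSum q 0 [x] = 1 := by
  simp [partitionSum, incr]

theorem partitionSum_singleton_succ (q : R) (k : ℕ) (x : ℕ+ × Fin r) :
    partitionSum q (k + 1) [x] = q * partitionSum q k [x] + 1 := by
  simp [partitionSum, splitSum, incr, partitionSum_nil]

theorem incr_cons_cons_of_colourLT {x y : ℕ+ × Fin r} (h : colourLT x y)
    (w : List (ℕ+ × Fin r)) : incr R (x :: y :: w) = incr R (y :: w) := by
  rw [incr_cons x]
  by_cases hy : ∀ z ∈ w, colourLT y z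
  · have : ∀ z ∈ w, colourLT x z := fun z hz => colourLT_trans h (hy z hz)
    rw [if_pos (List.forall_mem_cons.2 ⟨h, this⟩), one_mul]
  · rw [incr_cons y, if_neg hy, zero_mul, mul_zero]

theorem incr_cons_cons_of_not_colourLT {x y : ℕ+ × Fin r} (h : ¬ colourLT x y)
    (w : List (ℕ+ × Fin r)) : incr R (x :: y :: w) = 0 := by
  rw [incr_cons x]
  simp [h]

/-- Either `f₁ ≥ 1`, and `1` is subtracted from every value, or `f₁ = 0`, which at an ascent leaves
the remaining values unrestricted. -/
theorem partitionSum_succ_of_colourLT (q : R) (k : ℕ) {x y : ℕ+ × Fin r}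
    (h : colourLT x y) (w : List (ℕ+ × Fin r)) :
    partitionSum q (k + 1) (x :: y :: w) =
      q ^ (w.length + 2) * partitionSum q k (x :: y :: w) +
        partitionSum q (k + 1) (y :: w) := by
  rw [partitionSum, splitSum]
  simp only [splitSum, incr_cons_cons_of_colourLT h, incr_nil, List.length_cons]
  simp [incr]

/-- As at an ascent, except that `f₁ = 0` now forces `f₂ ≥ 1`, so `1` is also subtracted from the
remaining `w.length + 1` values. -/
theorem partitionSum_succ_of_not_colourLT (q : R) (k : ℕ) {x y : ℕ+ × Fin r}
    (h : ¬ colourLT x y) (w : List (ℕ+ × Fin r)) :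
    partitionSum q (k + 1) (x :: y :: w) =
      q ^ (w.length + 2) * partitionSum q k (x :: y :: w) +
        q ^ (w.length + 1) * partitionSum q k (y :: w) := by
  rw [partitionSum, splitSum]
  simp only [splitSum, incr_cons_cons_of_not_colourLT h, incr_nil, List.length_cons]
  simp [incr, splitSum_zero]

/-- Colours weakly decrease along an increasing word, so a first colour `0` makes all of them `0`.
-/
theorem colourless_mul_incr_cons_of_eq {x : ℕ+ × Fin r} (h : (x.2 : ℕ) = 0)
    (w : List (ℕ+ × Fin r)) :
    colourless R (x :: w) * incr R (x :: w) = incr R (x :: w) := by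
  rw [incr_cons]
  by_cases hw : ∀ z ∈ w, colourLT x z
  · have : ∀ z ∈ w, (z.2 : ℕ) = 0 := by
      intro z hz
      rcases hw z hz with h1 | ⟨h1, -⟩
      · have := Fin.lt_def.1 h1; omega
      · rw [← h1, h]
    have h1 : colourless R (x :: w) = 1 :=
      if_pos (by simpa only [List.forall_mem_cons] using ⟨h, this⟩)
    rw [h1, one_mul]
  · rw [if_neg hw, zero_mul, mul_zero]

theorem colourless_cons_of_ne {x : ℕ+ × Fin r} (h : (x.2 : ℕ) ≠ 0)
    (w : List (ℕ+ × Fin r)) : colourless R (x :: w) = 0 :=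
  if_neg fun h1 => h (h1 x (by simp))

theorem colouredPartitionSum_nil (q : R) (k : ℕ) :
    colouredPartitionSum q k ([] : List (ℕ+ × Fin r)) = 1 := by
  cases k <;>
    simp [colouredPartitionSum, splitSum, incr_nil, colourless_nil, partitionSum_nil]

theorem colouredPartitionSum_of_eq (q : R) (k : ℕ) {x : ℕ+ × Fin r} (h : (x.2 : ℕ) = 0)
    (w : List (ℕ+ × Fin r)) :
    colouredPartitionSum q k (x :: w) = partitionSum q k (x :: w) := by
  cases k with
  | zero => exact colourless_mul_incr_cons_of_eq h w
  | succ k =>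
    simp only [colouredPartitionSum, partitionSum, splitSum, colourless_mul_incr_cons_of_eq h,
      colourless_nil, one_mul]

theorem colouredPartitionSum_zero_of_ne (q : R) {x : ℕ+ × Fin r} (h : (x.2 : ℕ) ≠ 0)
    (w : List (ℕ+ × Fin r)) : colouredPartitionSum q 0 (x :: w) = 0 := by
  simp [colouredPartitionSum, colourless_cons_of_ne h]

theorem colouredPartitionSum_succ_of_ne (q : R) (k : ℕ) {x : ℕ+ × Fin r} (h : (x.2 : ℕ) ≠ 0)
    (w : List (ℕ+ × Fin r)) :
    colouredPartitionSum q (k + 1) (x :: w) =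
      q ^ (w.length + 1) * partitionSum q k (x :: w) := by
  simp [colouredPartitionSum, splitSum, colourless_cons_of_ne h, splitSum_zero, incr_nil,
    colourless_nil]

/-- Used for the subring of polynomials of degree `0` in the `p_j`, to see that the partition sums
do not affect that degree. -/
theorem partitionSum_mem {S : Subring R} {q : R} (hq : q ∈ S) (k : ℕ)
    (w : List (ℕ+ × Fin r)) : partitionSum q k w ∈ S := by
  have h1 : ∀ a : List (ℕ+ × Fin r), incr R a ∈ S := fun a => by
    unfold incr; split_ifs <;> simp [S.one_mem, S.zero_mem]
  induction k generalizing w with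
  | zero => exact h1 w
  | succ k ih =>
    exact splitSum_mem S.toSubsemiring.toAddSubmonoid _
      (fun a b => S.mul_mem (h1 a) (S.mul_mem (S.pow_mem hq _) (ih b))) w

theorem colouredPartitionSum_mem {S : Subring R} {q : R} (hq : q ∈ S) (k : ℕ)
    (w : List (ℕ+ × Fin r)) : colouredPartitionSum q k w ∈ S := by
  cases w with
  | nil => rw [colouredPartitionSum_nil]; exact S.one_mem
  | cons x w =>
    by_cases h : (x.2 : ℕ) = 0
    · rw [colouredPartitionSum_of_eq q k h]; exact partitionSum_mem hq k _
    · cases k with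
      | zero => rw [colouredPartitionSum_zero_of_ne q h]; exact S.zero_mem
      | succ k =>
        rw [colouredPartitionSum_succ_of_ne q k h]
        exact S.mul_mem (S.pow_mem hq _) (partitionSum_mem hq k _)

end Character

/-! ### Generating functions of words -/

section GeneratingFunction

variable {r : ℕ} {R : Type*} [CommRing R]

/-- The sum of `g (n - i)` over the descents `i ≥ 1` of a word of length `n`. -/
def descentSum (g : ℕ → ℕ) : List (ℕ+ × Fin r) → ℕ
  | x :: y :: w => (if colourLT y x then g (w.length + 1) else 0) + descentSum g (y :: w)
  | _ => 0

theorem sum_range_descent (g : ℕ → ℕ) (x : ℕ+ × Fin r) (w : List (ℕ+ × Fin r)) :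
    (∑ i ∈ Finset.range w.length,
      if ∃ u ∈ (x :: w)[i]?, ∃ v ∈ (x :: w)[i + 1]?, colourLT v u then g (w.length - i) else 0) =
      descentSum g (x :: w) := by
  induction w generalizing x with
  | nil => rfl
  | cons y w ih =>
    rw [descentSum, ← ih y, List.length_cons, Finset.sum_range_succ', add_comm]
    congr 1
    · simp
    · refine Finset.sum_congr rfl fun i _ => ?_
      rw [Nat.add_sub_add_right, List.getElem?_cons_succ, List.getElem?_cons_succ]

/-- Treats both statistics at once: `g = 1` gives `des` and `g = id` gives `comaj`. The separate
term is the possible descent at `0`. -/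
theorem ColPerm.sum_Des (g : ℕ → ℕ) (a : ColPerm r) {x : ℕ+ × Fin r} {w : List (ℕ+ × Fin r)}
    (h : a.word = x :: w) :
    ∑ i ∈ a.Des, g (a.length - i) =
      (if (x.2 : ℕ) ≠ 0 then g (w.length + 1) else 0) + descentSum g (x :: w) := by
  rw [← sum_range_descent, ColPerm.Des, Finset.sum_filter]
  simp only [ColPerm.length, h, List.length_cons]
  rw [Finset.sum_range_succ', add_comm]
  congr 1
  · simp [ColPerm.IsDescent, h]
  · refine Finset.sum_congr rfl fun i _ => ?_
    rw [Nat.add_sub_add_right]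
    simp only [ColPerm.IsDescent, h]

-- Induction on the word: multiplying by `1 - q ^ n t`, with `n` the length, removes the first
-- letter, and produces the factor `q ^ (n - 1) t` exactly when there is a descent at `1`.
open PowerSeries in
theorem mk_partitionSum_mul_prod (q : R) : ∀ w : List (ℕ+ × Fin r), (wordSymbols w).Nodup →
    PowerSeries.mk (fun k => partitionSum q k w) *
        ∏ i ∈ Finset.range (w.length + 1), (1 - C (q ^ i) * X) =
      C (q ^ descentSum (fun m => m) w) * X ^ descentSum (fun _ => 1) w
  | [], _ => by
      ext k
      simp only [partitionSum_nil, descentSum]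
      cases k <;> simp [mul_sub, coeff_succ_mul_X, coeff_one]
  | [x], _ => by
      rw [List.length_singleton, Finset.prod_range_succ, Finset.prod_range_one, mul_left_comm]
      have h : PowerSeries.mk (fun k => partitionSum q k [x]) * (1 - C (q ^ 1) * X) =
          PowerSeries.mk fun _ => 1 := by
        ext k
        cases k with
        | zero => simp [partitionSum_singleton_zero]
        | succ k =>
          rw [mul_sub, mul_one, mul_left_comm, map_sub, coeff_C_mul, coeff_succ_mul_X, coeff_mk,
            coeff_mk, coeff_mk, partitionSum_singleton_succ]
          ring
      rw [h]
      ext k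
      cases k <;> simp [sub_mul, coeff_succ_X_mul, coeff_one, descentSum]
  | x :: y :: w, h => by
      have ih := mk_partitionSum_mul_prod q (y :: w) (List.nodup_cons.1 h).2
      have hxy : x.1 ≠ y.1 := fun he => (List.nodup_cons.1 h).1 (by simp [he])
      -- Brings the last factor next to the series; the other factors form the product for `y :: w`.
      rw [List.length_cons, Finset.prod_range_succ, ← mul_assoc, mul_right_comm]
      rcases colourLT_or_colourLT hxy with hlt | hlt
      · have e : PowerSeries.mk (fun k => partitionSum q k (x :: y :: w)) *
            (1 - C (q ^ ((y :: w).length + 1)) * X) =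
            PowerSeries.mk fun k => partitionSum q k (y :: w) := by
          ext k
          cases k with
          | zero => simp [partitionSum, incr_cons_cons_of_colourLT hlt]
          | succ k =>
            rw [mul_sub, mul_one, mul_left_comm, map_sub, coeff_C_mul, coeff_succ_mul_X,
              coeff_mk, coeff_mk, coeff_mk, partitionSum_succ_of_colourLT q k hlt,
              List.length_cons]
            ring
        rw [e, ih, descentSum, descentSum, if_neg (colourLT_asymm hlt),
          if_neg (colourLT_asymm hlt), zero_add, zero_add]
      · have e : PowerSeries.mk (fun k => partitionSum q k (x :: y :: w)) *
            (1 - C (q ^ ((y :: w).length + 1)) * X) =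
            C (q ^ (w.length + 1)) * X * PowerSeries.mk fun k => partitionSum q k (y :: w) := by
          ext k
          cases k with
          | zero => simp [partitionSum, incr_cons_cons_of_not_colourLT (colourLT_asymm hlt)]
          | succ k =>
            rw [mul_sub, mul_one, mul_left_comm, map_sub, coeff_C_mul, coeff_succ_mul_X,
              mul_assoc, coeff_C_mul, coeff_succ_X_mul,
              coeff_mk, coeff_mk, coeff_mk,
              partitionSum_succ_of_not_colourLT q k (colourLT_asymm hlt), List.length_cons]
            ring
        rw [e, mul_assoc, ih, descentSum, descentSum, if_pos hlt, if_pos hlt, pow_add _ (w.length + 1),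
          pow_add X, map_mul, pow_one]
        ring

open PowerSeries in
theorem mk_colouredPartitionSum_mul_prod (q : R) (a : ColPerm r) :
    PowerSeries.mk (fun k => colouredPartitionSum q k a.word) *
        ∏ i ∈ Finset.range (a.length + 1), (1 - C (q ^ i) * X) =
      C (q ^ a.comaj) * X ^ a.des := by
  rcases hw : a.word with - | ⟨x, w⟩
  · have hl : a.length = ([] : List (ℕ+ × Fin r)).length := by rw [ColPerm.length, hw]
    have hD : a.Des = ∅ := by rw [ColPerm.Des, hl]; rfl
    have h := mk_partitionSum_mul_prod q ([] : List (ℕ+ × Fin r)) (by simp)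
    simp only [partitionSum_nil] at h
    simp only [colouredPartitionSum_nil, ColPerm.comaj, ColPerm.des, hD, hl]
    exact h
  · have hl : a.length = (x :: w).length := by rw [ColPerm.length, hw]
    have h := mk_partitionSum_mul_prod q (x :: w) (hw ▸ a.nodup)
    have hd : a.des = _ := (Finset.card_eq_sum_ones _).trans (a.sum_Des (fun _ => 1) hw)
    have hc : a.comaj = _ := a.sum_Des (fun m => m) hw
    rw [hl, hd, hc]
    by_cases hx : (x.2 : ℕ) = 0
    · simp only [colouredPartitionSum_of_eq q _ hx, hx, ne_eq, not_true_eq_false, if_false,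
        zero_add]
      exact h
    -- A nonzero first colour forces all values to be at least `1`. Subtracting `1` from each
    -- accounts for the descent at `0`.
    · have e : PowerSeries.mk (fun k => colouredPartitionSum q k (x :: w)) =
          C (q ^ (w.length + 1)) * X * PowerSeries.mk fun k => partitionSum q k (x :: w) := by
        ext k
        cases k with
        | zero => simp [colouredPartitionSum_zero_of_ne q hx]
        | succ k =>
          rw [mul_assoc, coeff_C_mul, coeff_succ_X_mul, coeff_mk, coeff_mk,
            colouredPartitionSum_succ_of_ne q k hx]
      rw [e, mul_assoc, h, if_pos hx, if_pos hx, pow_add _ (w.length + 1),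
        pow_add X, map_mul, pow_one]
      ring

end GeneratingFunction

namespace ColPerm

variable {r : ℕ}

theorem constantCoeff_denominator (a : ColPerm r) :
    PowerSeries.constantCoeff a.denominator = ((1 : (PolyPX r)ˣ) : PolyPX r) := by
  simp [denominator, map_prod]

theorem denominator_mul_invOfUnit (a : ColPerm r) :
    a.denominator * PowerSeries.invOfUnit a.denominator 1 = 1 :=
  PowerSeries.mul_invOfUnit _ _ a.constantCoeff_denominator

/-- The monomial `p^{col}` of a word. -/
def colourMonomial (w : List (ℕ+ × Fin r)) : PolyPX r :=
  ∏ j : Fin r, MvPolynomial.X (some j) ^ (w.map Prod.snd).count j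

theorem colourMonomial_of_perm (u v c : List (ℕ+ × Fin r)) (h : c.Perm (u ++ v)) :
    colourMonomial c = colourMonomial u * colourMonomial v := by
  simp only [colourMonomial, ← Finset.prod_mul_distrib, ← pow_add, ← List.count_append,
    ← List.map_append, (h.map Prod.snd).count_eq]

/-- The coefficients of the generating function of a coloured permutation with a given word. -/
def genCoeff (k : ℕ) (w : List (ℕ+ × Fin r)) : PolyPX r :=
  colourMonomial w * colouredPartitionSum (MvPolynomial.X none) k w

theorem isShuffleCharacter_genCoeff (k : ℕ) : IsShuffleCharacter (genCoeff (r := r) k) :=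
  (isShuffleCharacter_colouredPartitionSum _ k).mul_left colourMonomial_of_perm

theorem coeff_genFun (a : ColPerm r) (k : ℕ) :
    PowerSeries.coeff k a.genFun = genCoeff k a.word := by
  have h : a.genFun = PowerSeries.C (colourMonomial a.word) *
      PowerSeries.mk fun k => colouredPartitionSum (MvPolynomial.X none) k a.word := by
    rw [genFun, weight, map_mul, mul_assoc, mul_assoc,
      ← mul_assoc (PowerSeries.C (MvPolynomial.X none ^ a.comaj)),
      ← mk_colouredPartitionSum_mul_prod (MvPolynomial.X none) a, mul_assoc]
    -- The product over `Finset.range (a.length + 1)` is by definition the denominator, so it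
    -- cancels against its inverse.
    change _ * (_ * (a.denominator * _)) = _
    rw [denominator_mul_invOfUnit, mul_one]
    rfl
  rw [h, PowerSeries.coeff_C_mul, PowerSeries.coeff_mk, genCoeff]

/-- The coefficients of the generating functions multiply under shuffles. -/
theorem sum_coeff_genFun_shuffle (a b : ColPerm r) (h : a.IsDisjoint b) (k : ℕ) :
    ((a.shuffle b h).map fun c => PowerSeries.coeff k c.genFun).sum =
      PowerSeries.coeff k a.genFun * PowerSeries.coeff k b.genFun := by
  simp only [coeff_genFun]
  rw [← isShuffleCharacter_genCoeff k _ _ h, shuffleSum, ← ShuffleAlgebra.map_word_shuffle a b h,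
    Multiset.map_map]
  rfl

/-! ### Extraction of monomials -/

/-- The exponent of the monomial `p^v x^m`. -/
def exponent (m : ℕ) (v : Fin r → ℕ) : Option (Fin r) →₀ ℕ :=
  Finsupp.equivFunOnFinite.symm fun o => o.elim m v

theorem exponent_inj {m m' : ℕ} {v v' : Fin r → ℕ} :
    exponent m v = exponent m' v' ↔ m = m' ∧ v = v' := by
  refine ⟨fun h => ⟨?_, ?_⟩, fun h => by rw [h.1, h.2]⟩
  · exact DFunLike.congr_fun h none
  · exact funext fun j => DFunLike.congr_fun h (some j)

theorem weight_eq_monomial (a : ColPerm r) :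
    a.weight = MvPolynomial.monomial (exponent a.comaj a.col) 1 := by
  rw [MvPolynomial.monomial_eq, Finsupp.prod_fintype _ _ fun _ => pow_zero _,
    Fintype.prod_option, weight, map_one, one_mul, mul_comm]
  rfl

theorem coeff_coeff_weight (a : ColPerm r) (d m : ℕ) (v : Fin r → ℕ) :
    MvPolynomial.coeff (exponent m v)
        (PowerSeries.coeff d (PowerSeries.C a.weight * PowerSeries.X ^ a.des)) =
      if desComajCol r a = (d, m, v) then 1 else 0 := by
  rw [PowerSeries.coeff_C_mul, PowerSeries.coeff_X_pow, weight_eq_monomial]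
  change _ = if (a.des, a.comaj, a.col) = (d, m, v) then (1 : ℚ) else 0
  by_cases h : d = a.des
  · simp [h, MvPolynomial.coeff_monomial, exponent_inj]
  · simp [h, Ne.symm h]

theorem coeff_coeff_genFun_mul_denominator (a : ColPerm r) (d m : ℕ) (v : Fin r → ℕ) :
    MvPolynomial.coeff (exponent m v) (PowerSeries.coeff d (a.genFun * a.denominator)) =
      if desComajCol r a = (d, m, v) then 1 else 0 := by
  rw [genFun_mul_denominator, coeff_coeff_weight]

theorem genFun_congr {a b : ColPerm r} (hl : a.length = b.length)
    (hs : desComajCol r a = desComajCol r b) : a.genFun = b.genFun := by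
  obtain ⟨h1, h2, h3⟩ : a.des = b.des ∧ a.comaj = b.comaj ∧ a.col = b.col := by
    simpa [desComajCol] using hs
  simp only [genFun, weight, denominator, hl, h1, h2, h3]

/-- For coloured permutations of the same length, the sum of the generating functions
determines the multiset of the values of the statistics. -/
theorem map_desComajCol_eq (n : ℕ) (s s' : Multiset (ColPerm r)) (hs : ∀ c ∈ s, c.length = n)
    (hs' : ∀ c ∈ s', c.length = n)
    (h : (s.map genFun).sum = (s'.map genFun).sum) :
    s.map (desComajCol r) = s'.map (desComajCol r) := by
  classical
  let D : PowerSeries (PolyPX r) :=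
    ∏ i ∈ Finset.range (n + 1), (1 - PowerSeries.C (MvPolynomial.X none ^ i) * PowerSeries.X)
  have hD : ∀ c : ColPerm r, c.length = n → c.denominator = D := by
    rintro c rfl; rfl
  -- After multiplication by the common denominator `D`, each `c` contributes a single monomial, so
  -- coefficients count the occurrences of a value of the statistics.
  have key : ∀ (s : Multiset (ColPerm r)), (∀ c ∈ s, c.length = n) → ∀ d m v,
      MvPolynomial.coeff (exponent m v) (PowerSeries.coeff d ((s.map genFun).sum * D)) =
        ((s.map (desComajCol r)).count (d, m, v) : ℚ) := by
    intro s
    induction s using Multiset.induction with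
    | empty => intro _ d m v; simp
    | cons c s ih =>
      intro hs d m v
      rw [Multiset.map_cons, Multiset.sum_cons, add_mul, map_add, MvPolynomial.coeff_add,
        ih (fun c' hc' => hs c' (Multiset.mem_cons_of_mem hc')),
        ← hD c (hs c (Multiset.mem_cons_self c s)), coeff_coeff_genFun_mul_denominator,
        Multiset.map_cons, Multiset.count_cons, Nat.cast_add, add_comm]
      simp [eq_comm]
  ext ⟨d, m, v⟩
  have h1 := key s hs d m v
  rw [h, key s' hs' d m v] at h1
  exact_mod_cast h1.symm

/-- The sum of the generating functions over the shuffles is the Hadamard product of those of `a`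
and `b`, which depend only on lengths and statistics. -/
theorem shuffleCompatible_desComajCol : (desComajCol r).ShuffleCompatible := by
  intro a b a' b' h h' hla hlb hsa hsb
  refine map_desComajCol_eq (a.length + b.length) _ _
    (fun c hc => length_of_mem_shuffle hc)
    (fun c hc => by rw [length_of_mem_shuffle hc, hla, hlb]) ?_
  ext1 k
  rw [map_multiset_sum, map_multiset_sum, Multiset.map_map, Multiset.map_map]
  change ((a.shuffle b h).map fun c => PowerSeries.coeff k c.genFun).sum =
    ((a'.shuffle b' h').map fun c => PowerSeries.coeff k c.genFun).sum
  rw [sum_coeff_genFun_shuffle, sum_coeff_genFun_shuffle, genFun_congr hla hsa,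
    genFun_congr hlb hsb]

/-! ### Homogeneity -/

/-- The weights for which `p_j` has degree `1` and `x` has degree `0`. -/
def colourDegree (r : ℕ) : Option (Fin r) → ℕ := fun o => o.elim 0 fun _ => 1

theorem length_eq_sum_count (w : List (ℕ+ × Fin r)) :
    ∑ j : Fin r, (w.map Prod.snd).count j = w.length := by
  have h := Multiset.sum_count_eq_card (s := Finset.univ) (m := (w.map Prod.snd : Multiset (Fin r)))
    (fun _ _ => Finset.mem_univ _)
  simpa using h

/-- The subring of `ℚ[p, x]` of the polynomials of degree `0` in `p`. -/
def colourDegreeZero (r : ℕ) : Subring (PolyPX r) where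
  carrier := {f | MvPolynomial.IsWeightedHomogeneous (colourDegree r) f 0}
  mul_mem' hf hg := by simpa using MvPolynomial.IsWeightedHomogeneous.mul hf hg
  one_mem' := MvPolynomial.isWeightedHomogeneous_one _ _
  add_mem' hf hg := MvPolynomial.IsWeightedHomogeneous.add hf hg
  zero_mem' := MvPolynomial.isWeightedHomogeneous_zero _ _ _
  neg_mem' hf := MvPolynomial.IsWeightedHomogeneous.neg hf

theorem isWeightedHomogeneous_coeff_genFun (a : ColPerm r) (k : ℕ) :
    MvPolynomial.IsWeightedHomogeneous (colourDegree r) (PowerSeries.coeff k a.genFun)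
      a.length := by
  -- The degree is split as that of the colour monomial plus `0` for the partition sum.
  rw [coeff_genFun, genCoeff, length, ← length_eq_sum_count, ← add_zero (∑ j, _)]
  refine MvPolynomial.IsWeightedHomogeneous.mul
    (MvPolynomial.IsWeightedHomogeneous.prod _ _ _ fun j _ => ?_) ?_
  · simpa [colourDegree] using (MvPolynomial.isWeightedHomogeneous_X ℚ (colourDegree r)
      (some j)).pow ((a.word.map Prod.snd).count j)
  · exact colouredPartitionSum_mem (S := colourDegreeZero r)
      (MvPolynomial.isWeightedHomogeneous_X ℚ (colourDegree r) none) k a.word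

/-- A linear relation between generating functions splits according to the lengths. -/
theorem sum_filter_length_smul_genFun {ι : Type*} (s : Finset ι) (c : ι → ℚ)
    (a : ι → ColPerm r) (h : ∑ i ∈ s, c i • (a i).genFun = 0) (n : ℕ) :
    ∑ i ∈ s with (a i).length = n, c i • (a i).genFun = 0 := by
  classical
  ext1 k
  have hk := congrArg (fun f => MvPolynomial.weightedHomogeneousComponent (colourDegree r) n
    (PowerSeries.coeff k f)) h
  simp only [map_sum, map_zero] at hk ⊢
  rw [Finset.sum_filter]
  refine Eq.trans ?_ hk
  refine Finset.sum_congr rfl fun i _ => ?_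
  rw [PowerSeries.coeff_smul, map_smul,
    MvPolynomial.weightedHomogeneousComponent_of_mem (isWeightedHomogeneous_coeff_genFun (a i) k)]
  simp only [eq_comm (a := n), smul_ite, smul_zero]

/-- The generating functions of coloured permutations which are pairwise inequivalent are
linearly independent. -/
theorem linearIndependent_genFun {ι : Type*} (a : ι → ColPerm r)
    (ha : ∀ i j, (a i).length = (a j).length → desComajCol r (a i) = desComajCol r (a j) → i = j) :
    LinearIndependent ℚ fun i => (a i).genFun := by
  classical
  rw [linearIndependent_iff']
  intro s c h i₀ hi₀
  -- Within one length all denominators agree with that of `a i₀`; once it is cleared, the monomial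
  -- of `a i₀` occurs only in the term of `i₀`.
  have h1 := congrArg (fun f => MvPolynomial.coeff (exponent (a i₀).comaj (a i₀).col)
    (PowerSeries.coeff (a i₀).des (f * (a i₀).denominator)))
    (sum_filter_length_smul_genFun s c a h (a i₀).length)
  simp only [Finset.sum_mul, map_sum, MvPolynomial.coeff_sum, zero_mul, map_zero,
    MvPolynomial.coeff_zero] at h1
  rw [Finset.sum_eq_single i₀] at h1
  · rw [smul_mul_assoc, PowerSeries.coeff_smul, MvPolynomial.coeff_smul,
      coeff_coeff_genFun_mul_denominator, if_pos (by rfl)] at h1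
    simpa using h1
  · intro i hi hne
    have hl : (a i).length = (a i₀).length := (Finset.mem_filter.1 hi).2
    have hd : (a i₀).denominator = (a i).denominator := by rw [denominator, denominator, hl]
    rw [smul_mul_assoc, PowerSeries.coeff_smul, MvPolynomial.coeff_smul, hd,
      coeff_coeff_genFun_mul_denominator, if_neg, smul_zero]
    exact fun hs => hne (ha i i₀ hl hs)
  · intro hi
    exact (hi (by simpa using hi₀)).elim

end ColPerm

/-! ### The homomorphism -/

namespace ShuffleAlgebra

variable {r : ℕ}

/-- The linear map `[a] ↦ p^{col(a)} x^{comaj(a)} t^{des(a)} / ((1 - t) ⋯ (1 - x^{|a|} t))`. -/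
def genFunMap (hst : (desComajCol r).ShuffleCompatible) :
    ShuffleAlgebra (desComajCol r) hst →ₗ[ℚ] HadamardSeries (PolyPX r) :=
  (basis hst).constr ℚ fun q => HadamardSeries.ofPowerSeries q.out.genFun

theorem genFunMap_cls (hst : (desComajCol r).ShuffleCompatible) (a : ColPerm r) :
    genFunMap hst (cls hst a) = HadamardSeries.ofPowerSeries a.genFun := by
  rw [genFunMap, cls, Module.Basis.constr_basis]
  have h : (desComajCol r).equivalence _ a :=
    Quotient.mk_out (s := (desComajCol r).equivalence) a
  rw [ColPerm.genFun_congr h.1 h.2]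

/-- The empty word has generating function `1 / (1 - t)`, the Hadamard unit. -/
theorem genFunMap_one (hst : (desComajCol r).ShuffleCompatible) : genFunMap hst 1 = 1 := by
  change genFunMap hst (cls hst (ColPerm.empty r)) = 1
  rw [genFunMap_cls]
  ext1 k
  rw [HadamardSeries.coeff_one]
  change PowerSeries.coeff k (ColPerm.empty r).genFun = 1
  rw [ColPerm.coeff_genFun, ColPerm.genCoeff, ColPerm.empty, colouredPartitionSum_nil]
  simp [ColPerm.colourMonomial]

theorem genFunMap_cls_mul_cls (hst : (desComajCol r).ShuffleCompatible) (a b : ColPerm r)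
    (h : a.IsDisjoint b) :
    genFunMap hst (cls hst a * cls hst b) =
      genFunMap hst (cls hst a) * genFunMap hst (cls hst b) := by
  rw [cls_mul_cls hst a b h, map_multiset_sum, Multiset.map_map]
  simp only [Function.comp_def, genFunMap_cls]
  ext1 k
  rw [HadamardSeries.coeff_mul]
  change PowerSeries.coeff k (Multiset.map ColPerm.genFun _).sum = _
  rw [map_multiset_sum, Multiset.map_map]
  exact ColPerm.sum_coeff_genFun_shuffle a b h k

theorem genFunMap_mul (hst : (desComajCol r).ShuffleCompatible)
    (x y : ShuffleAlgebra (desComajCol r) hst) :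
    genFunMap hst (x * y) = genFunMap hst x * genFunMap hst y := by
  induction x using induction_cls hst with
  | zero => simp
  | add x x' hx hx' => rw [add_mul, map_add, hx, hx', map_add, add_mul]
  | smul t x hx => rw [smul_mul_assoc, map_smul, hx, map_smul, smul_mul_assoc]
  | cls a =>
    induction y using induction_cls hst with
    | zero => simp
    | add y y' hy hy' => rw [mul_add, map_add, hy, hy', map_add, mul_add]
    | smul t y hy => rw [mul_smul_comm, map_smul, hy, map_smul, mul_smul_comm]
    | cls b =>
      rw [← cls_toEven hst a, ← cls_toOdd hst b]
      exact genFunMap_cls_mul_cls hst _ _ (disjoint_even_odd a b)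

theorem genFunMap_injective (hst : (desComajCol r).ShuffleCompatible) :
    Function.Injective (genFunMap hst) := by
  have h : LinearIndependent ℚ fun q : (desComajCol r).Class => q.out.genFun :=
    ColPerm.linearIndependent_genFun _ fun p q hl hs => by
      rw [← Quotient.out_eq p, ← Quotient.out_eq q]
      exact Quotient.sound (s := (desComajCol r).equivalence) ⟨hl, hs⟩
  exact (basis hst).injective_constr_of_linearIndependent h

/-- The homomorphism from the shuffle algebra to the power series with the Hadamard product. -/
def genFunHom (hst : (desComajCol r).ShuffleCompatible) :
    ShuffleAlgebra (desComajCol r) hst →ₐ[ℚ] HadamardSeries (PolyPX r) :=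
  AlgHom.ofLinearMap (genFunMap hst) (genFunMap_one hst) (genFunMap_mul hst)

end ShuffleAlgebra

end

theorem mainTheorem2 (r : ℕ) :
    ∃ hst : (desComajCol r).ShuffleCompatible,
      ∃ H : ShuffleAlgebra (desComajCol r) hst →ₐ[ℚ] HadamardSeries (PolyPX r),
        (∀ a : ColPerm r,
          H (ShuffleAlgebra.cls hst a) = HadamardSeries.ofPowerSeries a.genFun) ∧
        Function.Injective H :=
  ⟨ColPerm.shuffleCompatible_desComajCol, ShuffleAlgebra.genFunHom _,
    ShuffleAlgebra.genFunMap_cls _, ShuffleAlgebra.genFunMap_injective _⟩
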